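/- Let $\mathcal H$ be a real Hilbert space, $\mathcal G$ a normed space and $\mathcal D\subset\mathcal G$ a nonempty set with the induced topology (all neighbourhoods of points of $\mathcal D$ are taken in $\mathcal D$). Let $I_1,I_2$ be disjoint finite index sets, at least one of them nonempty, let $f_i:\mathcal D\to\mathbb R$ and $g_i:\mathcal D\to\mathcal H$ ($i\in I_1\cup I_2$) be locally Lipschitz on $\mathcal D$, and for $p\in\mathcal D$ let $$C(p)=\{x\in\mathcal H:\ \langle x\mid g_i(p)\rangle=f_i(p)\ (i\in I_1),\ \ \langle x\mid g_i(p)\rangle\le f_i(p)\ (i\in I_2)\}.$$ For $C(p)\ne\emptyset$ and $v\in\mathcal H$ let $P(v,p)$ be the projection of $v$ onto $C(p)$, i.e. the unique minimizer of $\frac12\|x-v\|^2$ over $x\in C(p)$. Let $\bar p\in\mathcal D$, $\bar v\in\mathcal H\setminus C(\bar p)$, $\bar x\in C(\bar p)$, and let $I_{\bar p}(\bar x)=\{i\in I_1\cup I_2:\ \langle\bar x\mid g_i(\bar p)\rangle=f_i(\bar p)\}$. Assume: (1) (RCRCQ at $(\bar p,\bar x)$) There is a neighbourhood $U_0$ of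 $\bar p$ such that $\operatorname{rank}\{g_i(p):i\in J\}=\operatorname{rank}\{g_i(\bar p):i\in J\}$ for every $J$ with $I_1\subset J\subset I_{\bar p}(\bar x)$ and every $p\in U_0$. (2) ($C$ is a stable representation at $(\bar p,\bar v,\bar x)$) There is a set $\bar K\subset I_{\bar p}(\bar x)\cap I_2$, possibly empty, such that - the vectors $g_i(\bar p)$, $i\in I_1\cup\bar K$, are linearly independent and $\bar v-\bar x=\sum_{i\in I_1\cup\bar K}\bar\lambda_i g_i(\bar p)$ with real $\bar\lambda_i$, where $\bar\lambda_i>0$ for $i\in\bar K$; - for every (possibly empty) $L\subset(I_{\bar p}(\bar x)\cap I_2)\setminus\bar K$ for which $g_i(\bar p)$, $i\in I_1\cup\bar K\cup L$, are linearly independent, $\bar x$ belongs to the lower Kuratowski limit as $p\to\bar p$, $p\in\mathcal D$, of the sets $$C_{\bar K,L}(p)=\{x\in\mathcal H:\ \langle x\mid g_i(p)\rangle=f_i(p)\ (i\in I_1\cup\bar K\cup L),\ \ \langle x\mid g_i(p)\rangle\le f_i(p)\ (i\in I_2\setminus(\bar K\cup L))\},$$ that is, for every neighbourhood $V$ of $\bar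 x$ there is a neighbourhood $U$ of $\bar p$ with $V\cap C_{\bar K,L}(p)\ne\emptyset$ for all $p\in U$. Then there exist neighbourhoods $W$ of $\bar v$ and $U$ of $\bar p$ and a constant $\ell^0>0$ such that $C(p)\neq\emptyset$ for all $p\in U$ (so that $P$ is defined on $W\times U$) and $$\|(v_1-v_2)-2[P(v_1,p_1)-P(v_2,p_2)]\|\le\|v_1-v_2\|+\ell^0\|p_1-p_2\|$$ for all $(v_1,p_1),(v_2,p_2)\in W\times U$. -/

import Mathlib

open Filter Topology

noncomputable section

namespace ParamProj

section Basic

variable {H : Type*} [NormedAddCommGroup H]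

/-- `x` is a point of `S` nearest to `v`, i.e. a solution of
`minimize (1/2) * ‖x - v‖ ^ 2` subject to `x ∈ S`. -/
def IsProjection (S : Set H) (v x : H) : Prop :=
  x ∈ S ∧ ∀ y ∈ S, 1 / 2 * ‖x - v‖ ^ 2 ≤ 1 / 2 * ‖y - v‖ ^ 2

/-- The projection of `v` onto `S`: the (in a Hilbert space, for closed convex nonempty `S`, unique)
point of `S` nearest to `v`. -/
def projection (S : Set H) (v : H) : H :=
  letI : Nonempty H := ⟨0⟩
  Classical.epsilon (IsProjection S v)

/-- The lower Kuratowski limit of a multifunction `F` at `p₀`: every neighbourhood of the point meets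
`F p` for all `p` close to `p₀`. -/
def lowerLimit {P : Type*} [TopologicalSpace P] (F : P → Set H) (p₀ : P) : Set H :=
  {y | ∀ V ∈ 𝓝 y, ∃ U ∈ 𝓝 p₀, ∀ p ∈ U, (V ∩ F p).Nonempty}

end Basic

section Systems

variable {ι P H : Type*} [DecidableEq ι] [NormedAddCommGroup H] [InnerProductSpace ℝ H]

/-- The set of all `x` with `⟪x, g i p⟫ = f i p` for `i ∈ I₁` and `⟪x, g i p⟫ ≤ f i p` for `i ∈ I₂`. -/
def feasible (I₁ I₂ : Finset ι) (f : ι → P → ℝ) (g : ι → P → H) (p : P) : Set H :=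
  {x | (∀ i ∈ I₁, inner ℝ x (g i p) = f i p) ∧ (∀ i ∈ I₂, inner ℝ x (g i p) ≤ f i p)}

/-- The set of indices of the constraints that are active at `x` for the parameter `p`. -/
def active (I₁ I₂ : Finset ι) (f : ι → P → ℝ) (g : ι → P → H) (p : P) (x : H) : Set ι :=
  {i | i ∈ I₁ ∪ I₂ ∧ inner ℝ x (g i p) = f i p}

/-- The relaxed constant rank constraint qualification at `(p₀, x₀)`, where `x₀` is feasible
for `p₀`. -/
def RCRCQ [TopologicalSpace P] (I₁ I₂ : Finset ι) (f : ι → P → ℝ) (g : ι → P → H)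
    (p₀ : P) (x₀ : H) : Prop :=
  x₀ ∈ feasible I₁ I₂ f g p₀ ∧
  ∃ U ∈ 𝓝 p₀, ∀ J : Finset ι, I₁ ⊆ J → (J : Set ι) ⊆ active I₁ I₂ f g p₀ x₀ → ∀ p ∈ U,
    Module.finrank ℝ (Submodule.span ℝ ((fun i => g i p) '' (J : Set ι))) =
      Module.finrank ℝ (Submodule.span ℝ ((fun i => g i p₀) '' (J : Set ι)))

/-- The index sets `L` (possibly empty) of active inequality constraints outside `K` for which the
vectors `g i p₀`, `i ∈ I₁ ∪ K ∪ L`, are linearly independent. -/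
def Admissible (I₁ I₂ : Finset ι) (f : ι → P → ℝ) (g : ι → P → H)
    (p₀ : P) (x₀ : H) (K L : Finset ι) : Prop :=
  (L : Set ι) ⊆ (active I₁ I₂ f g p₀ x₀ ∩ (I₂ : Set ι)) \ (K : Set ι) ∧
  LinearIndepOn ℝ (fun i => g i p₀) ((I₁ ∪ K ∪ L : Finset ι) : Set ι)

/-- The multifunction obtained by turning the inequality constraints with index in `K ∪ L` into
equality constraints. -/
def reduced (I₁ I₂ : Finset ι) (f : ι → P → ℝ) (g : ι → P → H) (K L : Finset ι) (p : P) : Set H :=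
  feasible (I₁ ∪ K ∪ L) (I₂ \ (K ∪ L)) f g p

/-- The system is a stable representation at `(p₀, v₀, x₀)` with the index set `K`. -/
def IsStableWith [TopologicalSpace P] (I₁ I₂ : Finset ι) (f : ι → P → ℝ) (g : ι → P → H)
    (p₀ : P) (v₀ x₀ : H) (K : Finset ι) : Prop :=
  v₀ ∉ feasible I₁ I₂ f g p₀ ∧ x₀ ∈ feasible I₁ I₂ f g p₀ ∧
  (K : Set ι) ⊆ active I₁ I₂ f g p₀ x₀ ∩ (I₂ : Set ι) ∧
  (∃ lam : ι → ℝ, (∀ i ∈ K, 0 < lam i) ∧ v₀ - x₀ = ∑ i ∈ I₁ ∪ K, lam i • g i p₀) ∧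
  LinearIndepOn ℝ (fun i => g i p₀) ((I₁ ∪ K : Finset ι) : Set ι) ∧
  ∀ L : Finset ι, Admissible I₁ I₂ f g p₀ x₀ K L →
    x₀ ∈ lowerLimit (reduced I₁ I₂ f g K L) p₀

end Systems

end ParamProj

end

open Filter Topology

namespace ParamProj

/-! ### Projections onto closed convex sets. -/

section Projection

/-! For a fixed parameter the reflected projection is nonexpansive
(`IsProjection.norm_sub_two_smul_sub_le`), so passing through the mixed point `P(v₂, p₁)` reduces
the theorem to a Lipschitz estimate in `p` alone, uniform in `v` near `v₀`
(`eventually_projection_lipschitz`).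

That estimate transports multipliers. Near `(v₀, p₀)` the projection `x` of `v` onto `C(p)`
satisfies the equations indexed by `I₁ ∪ K ∪ L` for some admissible `L`, with bounded multipliers
that are nonnegative on `K ∪ L` (`eventually_exists_isKKTPoint`). The system with these equations is
pseudo-Lipschitz (`eventually_exists_near`), so at `q` it has a solution `z` within `O(dist p q)` of
`x`. By sufficiency of KKT, `z` is the projection onto `C(q)` of `z` plus the same multipliers times
the gradients at `q`. That point is within `O(dist p q)` of `v`, and nonexpansiveness bounds the
distance from `z` to the projection of `v`.

Both ingredients use multipliers for linearly independent gradients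
(`IsProjection.exists_multipliers`); constant rank carries independence between `p` and `p₀`, which
bounds these multipliers uniformly. -/

theorem IsProjection.of_subset {H : Type*} [NormedAddCommGroup H] {S T : Set H} {v x : H} (h : IsProjection S v x) (hT : T ⊆ S)
    (hx : x ∈ T) : IsProjection T v x := ⟨hx, fun y hy => h.2 y (hT hy)⟩

variable {H : Type*} [NormedAddCommGroup H] [InnerProductSpace ℝ H]

theorem isProjection_iff_norm_le {H : Type*} [NormedAddCommGroup H] {S : Set H} {v x : H} :
    IsProjection S v x ↔ x ∈ S ∧ ∀ y ∈ S, ‖v - x‖ ≤ ‖v - y‖ := by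
  unfold IsProjection
  refine and_congr_right fun _ => forall₂_congr fun y _ => ?_
  rw [norm_sub_rev v x, norm_sub_rev v y, mul_le_mul_iff_right₀ (by norm_num : (0 : ℝ) < 1 / 2)]
  exact pow_le_pow_iff_left₀ (norm_nonneg _) (norm_nonneg _) two_ne_zero

theorem isProjection_iff_inner_le {S : Set H} (hS : Convex ℝ S) {v x : H} :
    IsProjection S v x ↔ x ∈ S ∧ ∀ y ∈ S, inner ℝ (v - x) (y - x) ≤ 0 := by
  rw [isProjection_iff_norm_le]
  refine and_congr_right fun hx => ?_
  rw [← norm_eq_iInf_iff_real_inner_le_zero hS hx]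
  have hbdd : BddBelow (Set.range fun y : S => ‖v - y‖) :=
    ⟨0, by rintro _ ⟨y, rfl⟩; exact norm_nonneg _⟩
  have : Nonempty S := ⟨⟨x, hx⟩⟩
  constructor
  · intro h
    exact le_antisymm (le_ciInf fun y => h y y.2) (ciInf_le hbdd ⟨x, hx⟩)
  · intro h y hy
    rw [h]
    exact ciInf_le hbdd ⟨y, hy⟩

/-- Firm nonexpansiveness, by adding the two variational inequalities, each tested at the other
projection. -/
theorem IsProjection.inner_sub_le {S : Set H} (hS : Convex ℝ S) {v₁ v₂ x₁ x₂ : H}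
    (h₁ : IsProjection S v₁ x₁) (h₂ : IsProjection S v₂ x₂) :
    ‖x₁ - x₂‖ ^ 2 ≤ inner ℝ (v₁ - v₂) (x₁ - x₂) := by
  have a := ((isProjection_iff_inner_le hS).1 h₁).2 x₂ h₂.1
  have b := ((isProjection_iff_inner_le hS).1 h₂).2 x₁ h₁.1
  rw [← real_inner_self_eq_norm_sq]
  simp only [inner_sub_left, inner_sub_right] at *
  linarith

theorem IsProjection.norm_sub_le {S : Set H} (hS : Convex ℝ S) {v₁ v₂ x₁ x₂ : H}
    (h₁ : IsProjection S v₁ x₁) (h₂ : IsProjection S v₂ x₂) :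
    ‖x₁ - x₂‖ ≤ ‖v₁ - v₂‖ := by
  have h := (h₁.inner_sub_le hS h₂).trans (real_inner_le_norm _ _)
  rcases (norm_nonneg (x₁ - x₂)).eq_or_lt with h0 | h0
  · rw [← h0]; exact norm_nonneg _
  · rw [sq] at h
    exact le_of_mul_le_mul_right h h0

theorem IsProjection.unique {S : Set H} (hS : Convex ℝ S) {v x₁ x₂ : H}
    (h₁ : IsProjection S v x₁) (h₂ : IsProjection S v x₂) : x₁ = x₂ := by
  have := h₁.norm_sub_le hS h₂
  rw [sub_self, norm_zero, norm_le_zero_iff, sub_eq_zero] at this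
  exact this

/-- The reflected projection is nonexpansive. -/
theorem IsProjection.norm_sub_two_smul_sub_le {S : Set H} (hS : Convex ℝ S) {v₁ v₂ x₁ x₂ : H}
    (h₁ : IsProjection S v₁ x₁) (h₂ : IsProjection S v₂ x₂) :
    ‖(v₁ - v₂) - (2 : ℝ) • (x₁ - x₂)‖ ≤ ‖v₁ - v₂‖ := by
  refine le_of_sq_le_sq ?_ (norm_nonneg _)
  rw [norm_sub_sq_real, inner_smul_right, norm_smul, Real.norm_two]
  linarith [h₁.inner_sub_le hS h₂]

theorem exists_isProjection [CompleteSpace H] {S : Set H} (hS : Convex ℝ S) (hc : IsClosed S)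
    (hne : S.Nonempty) (v : H) : ∃ x, IsProjection S v x := by
  obtain ⟨x, hx, h⟩ := exists_norm_eq_iInf_of_complete_convex hne hc.isComplete hS v
  exact ⟨x, (isProjection_iff_inner_le hS).2
    ⟨hx, (norm_eq_iInf_iff_real_inner_le_zero hS hx).1 h⟩⟩

theorem IsProjection.projection_eq {S : Set H} (hS : Convex ℝ S) {v x : H}
    (h : IsProjection S v x) : projection S v = x :=
  IsProjection.unique hS (Classical.epsilon_spec (⟨x, h⟩ : ∃ x, IsProjection S v x)) h

end Projection

/-! ### Karush-Kuhn-Tucker conditions. -/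

section KKT

variable {ι P H : Type*} [NormedAddCommGroup H] [InnerProductSpace ℝ H]
  {f : ι → P → ℝ} {g : ι → P → H} {p : P}

theorem convex_feasible (E B : Finset ι) : Convex ℝ (feasible E B f g p) := by
  intro x hx y hy a b ha hb hab
  refine ⟨fun i hi => ?_, fun i hi => ?_⟩
  · rw [inner_add_left, real_inner_smul_left, real_inner_smul_left, hx.1 i hi, hy.1 i hi,
      ← add_mul, hab, one_mul]
  · rw [inner_add_left, real_inner_smul_left, real_inner_smul_left]
    calc _ ≤ a * f i p + b * f i p := by gcongr <;> [exact hx.2 i hi; exact hy.2 i hi]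
      _ = _ := by rw [← add_mul, hab, one_mul]

theorem isClosed_feasible (E B : Finset ι) : IsClosed (feasible E B f g p) := by
  have : feasible E B f g p = (⋂ i ∈ E, {x | inner ℝ x (g i p) = f i p}) ∩
      ⋂ i ∈ B, {x | inner ℝ x (g i p) ≤ f i p} := by
    ext x; simp [feasible]
  rw [this]
  refine (isClosed_biInter fun i _ => isClosed_eq (by fun_prop) (by fun_prop)).inter
    (isClosed_biInter fun i _ => isClosed_le (by fun_prop) (by fun_prop))

/-- Sufficiency of the Karush-Kuhn-Tucker conditions. -/
theorem isProjection_of_multipliers [DecidableEq ι] {E B M : Finset ι} {v x : H} {μ : ι → ℝ}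
    (hx : x ∈ feasible E B f g p) (hM : M ⊆ E ∪ B)
    (hact : ∀ i ∈ M, inner ℝ x (g i p) = f i p) (hμ : ∀ i ∈ M, i ∉ E → 0 ≤ μ i)
    (hv : v - x = ∑ i ∈ M, μ i • g i p) : IsProjection (feasible E B f g p) v x := by
  refine (isProjection_iff_inner_le (convex_feasible E B)).2 ⟨hx, fun y hy => ?_⟩
  rw [hv, sum_inner]
  refine Finset.sum_nonpos fun i hi => ?_
  rw [real_inner_smul_left, real_inner_comm, inner_sub_left, hact i hi]
  by_cases hE : i ∈ E
  · rw [hy.1 i hE, sub_self, mul_zero]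
  · have hB : i ∈ B := (Finset.mem_union.1 (hM hi)).resolve_left hE
    exact mul_nonpos_of_nonneg_of_nonpos (hμ i hi hE) (sub_nonpos.2 (hy.2 i hB))

/-- Necessity of the Karush-Kuhn-Tucker conditions, with linearly independent gradients. -/
theorem IsProjection.exists_multipliers [DecidableEq ι] {v x : H} (B : Finset ι) :
    ∀ E : Finset ι, Disjoint E B → LinearIndepOn ℝ (fun i => g i p) (E : Set ι) →
      IsProjection (feasible E B f g p) v x →
      ∃ M ⊆ B, ∃ μ : ι → ℝ, (∀ i ∈ M, 0 ≤ μ i) ∧ (∀ i ∈ M, inner ℝ x (g i p) = f i p) ∧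
        LinearIndepOn ℝ (fun i => g i p) ((E ∪ M : Finset ι) : Set ι) ∧
        v - x = ∑ i ∈ E ∪ M, μ i • g i p := by
  induction B using Finset.induction_on with
  | empty =>
    intro E _ hE hx
    set V := Submodule.span ℝ ((fun i => g i p) '' (E : Set ι)) with hV
    have : FiniteDimensional ℝ V :=
      FiniteDimensional.span_of_finite ℝ (E.finite_toSet.image _)
    -- Every `d ∈ Vᗮ` is a feasible direction in both senses, so `v - x ∈ Vᗮᗮ`, which is `V` by
    -- finite dimension.
    have key : v - x ∈ V := by
      rw [← Submodule.orthogonal_orthogonal V, Submodule.mem_orthogonal]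
      intro d hd
      have hd' : ∀ i ∈ E, inner ℝ d (g i p) = 0 := fun i hi => by
        rw [real_inner_comm]
        exact (Submodule.mem_orthogonal V d).1 hd _
          (Submodule.subset_span (Set.mem_image_of_mem _ hi))
      have hin := ((isProjection_iff_inner_le (convex_feasible E ∅)).1 hx).2
      have h₁ := hin (x + d) ⟨fun i hi => by
        rw [inner_add_left, hd' i hi, add_zero, hx.1.1 i hi], by simp⟩
      have h₂ := hin (x - d) ⟨fun i hi => by
        rw [inner_sub_left, hd' i hi, sub_zero, hx.1.1 i hi], by simp⟩
      rw [add_sub_cancel_left] at h₁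
      rw [sub_sub_cancel_left, inner_neg_right] at h₂
      rw [real_inner_comm]
      linarith
    obtain ⟨μ, hμ⟩ := (Submodule.mem_span_image_finset_iff_exists_fun' ℝ).1 key
    exact ⟨∅, Finset.Subset.refl _, μ, by simp, by simp, by simpa using hE, by simpa using hμ.symm⟩
  | insert i B hi ih =>
    intro E hd hE hx
    rw [Finset.disjoint_insert_right] at hd
    -- Either constraint `i` can be dropped, or a point `z` of the larger set is strictly closer to
    -- `v`; then `i` is active at `x` and is promoted to an equation.
    by_cases hproj : IsProjection (feasible E B f g p) v x
    · obtain ⟨M, hM, h⟩ := ih E hd.2 hE hproj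
      exact ⟨M, hM.trans (Finset.subset_insert _ _), h⟩
    have hxB : x ∈ feasible E B f g p :=
      ⟨hx.1.1, fun j hj => hx.1.2 j (Finset.mem_insert_of_mem hj)⟩
    rw [isProjection_iff_norm_le] at hproj
    push Not at hproj
    obtain ⟨z, hz, hzv⟩ := hproj hxB
    have hzi : f i p < inner ℝ z (g i p) := by
      by_contra! h
      have : z ∈ feasible E (insert i B) f g p := by
        refine ⟨hz.1, fun j hj => ?_⟩
        rcases Finset.mem_insert.1 hj with rfl | hj
        · exact h
        · exact hz.2 j hj
      exact absurd ((isProjection_iff_norm_le.1 hx).2 z this) (not_le.2 hzv)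
    have hpos : 0 < inner ℝ (v - x) (z - x) := by
      have h1 : ‖v - z‖ ^ 2 < ‖v - x‖ ^ 2 := by gcongr
      have h2 : v - z = (v - x) - (z - x) := by abel
      rw [h2, norm_sub_sq_real] at h1
      nlinarith [sq_nonneg ‖z - x‖]
    -- Otherwise the segment from `x` to `z` stays feasible up to the point with parameter `t`,
    -- where it meets the hyperplane of `i`, contradicting optimality of `x`.
    have hxi : inner ℝ x (g i p) = f i p := by
      by_contra hne
      have hlt := lt_of_le_of_ne (hx.1.2 i (Finset.mem_insert_self _ _)) hne
      have hcv := (isProjection_iff_inner_le (convex_feasible E (insert i B))).1 hx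
      set a := inner ℝ x (g i p)
      set b := inner ℝ z (g i p)
      have hab : 0 < b - a := by linarith
      set t := (f i p - a) / (b - a) with ht
      have ht0 : 0 < t := div_pos (by linarith) hab
      have ht1 : t ≤ 1 := (div_le_one hab).2 (by linarith)
      have hmem := convex_feasible E B hxB hz (sub_nonneg.2 ht1) ht0.le (by ring)
      have hy := hcv.2 ((1 - t) • x + t • z) ⟨hmem.1, fun j hj => by
        rcases Finset.mem_insert.1 hj with rfl | hj
        · rw [inner_add_left, real_inner_smul_left, real_inner_smul_left]
          change (1 - t) * a + t * b ≤ _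
          have : t * (b - a) = f j p - a := div_mul_cancel₀ _ hab.ne'
          linarith
        · exact hmem.2 j hj⟩
      have : (1 - t) • x + t • z - x = t • (z - x) := by module
      rw [this, real_inner_smul_right] at hy
      exact absurd hy (not_le.2 (mul_pos ht0 hpos))
    -- `z - x` is orthogonal to the gradients from `E` but not to `g i p`.
    have hspan : g i p ∉ Submodule.span ℝ ((fun j => g j p) '' (E : Set ι)) := by
      intro h
      have : ∀ u ∈ Submodule.span ℝ ((fun j => g j p) '' (E : Set ι)),
          inner ℝ (z - x) u = 0 := by
        intro u hu
        induction hu using Submodule.span_induction with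
        | mem u hu =>
          obtain ⟨j, hj, rfl⟩ := hu
          rw [inner_sub_left, hz.1 j hj, hx.1.1 j hj, sub_self]
        | zero => exact inner_zero_right _
        | add a b _ _ ha hb => rw [inner_add_right, ha, hb, add_zero]
        | smul c a _ ha => rw [real_inner_smul_right, ha, mul_zero]
      have h0 := this _ h
      rw [inner_sub_left] at h0
      linarith
    have hE' : LinearIndepOn ℝ (fun j => g j p) ((insert i E : Finset ι) : Set ι) := by
      rw [Finset.coe_insert]
      exact hE.insert hspan
    have hx' : IsProjection (feasible (insert i E) B f g p) v x := by
      refine hx.of_subset (fun y hy => ⟨fun j hj => hy.1 j (Finset.mem_insert_of_mem hj),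
        fun j hj => ?_⟩) ⟨fun j hj => ?_, hxB.2⟩
      · rcases Finset.mem_insert.1 hj with rfl | hj
        · exact (hy.1 j (Finset.mem_insert_self _ _)).le
        · exact hy.2 j hj
      · rcases Finset.mem_insert.1 hj with rfl | hj
        · exact hxi
        · exact hx.1.1 j hj
    obtain ⟨M, hM, μ, hμ, hact, hind, hsum⟩ :=
      ih (insert i E) (Finset.disjoint_insert_left.2 ⟨hi, hd.2⟩) hE' hx'
    have hEM : insert i E ∪ M = E ∪ insert i M := by
      rw [Finset.insert_union, Finset.union_insert]
    refine ⟨insert i M, Finset.insert_subset_insert _ hM, μ, ?_, ?_, hEM ▸ hind, hEM ▸ hsum⟩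
    · intro j hj
      rcases Finset.mem_insert.1 hj with rfl | hj
      -- Sign of the new multiplier: pair `v - x` with `z - x`. The total is positive, terms from
      -- `E` vanish and those from `M` are nonpositive, so the term of `j` is positive.
      · rw [hsum, sum_inner, Finset.insert_union, Finset.sum_insert] at hpos
        · have hrest : ∑ k ∈ E ∪ M, inner ℝ (μ k • g k p) (z - x) ≤ 0 := by
            refine Finset.sum_nonpos fun k hk => ?_
            rw [real_inner_smul_left, real_inner_comm, inner_sub_left]
            by_cases hkE : k ∈ E
            · rw [hz.1 k hkE, hx.1.1 k hkE, sub_self, mul_zero]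
            · have hkM := (Finset.mem_union.1 hk).resolve_left hkE
              rw [hact k hkM]
              exact mul_nonpos_of_nonneg_of_nonpos (hμ k hkM)
                (sub_nonpos.2 (hz.2 k (hM hkM)))
          have h1 : 0 < μ j * (inner ℝ z (g j p) - f j p) := by
            have : inner ℝ (μ j • g j p) (z - x) = μ j * (inner ℝ z (g j p) - f j p) := by
              rw [real_inner_smul_left, real_inner_comm, inner_sub_left, hxi]
            linarith
          exact (pos_of_mul_pos_left h1 (sub_pos.2 hzi).le).le
        · rw [Finset.mem_union]
          rintro (h | h)
          · exact hd.1 h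
          · exact hi (hM h)
      · exact hμ j hj
    · intro j hj
      rcases Finset.mem_insert.1 hj with rfl | hj
      · exact hxi
      · exact hact j hj

end KKT


/-! ### Uniform local constants and the pseudo-Lipschitz property. -/

section LocalBounds

variable {ι P H : Type*} [NormedAddCommGroup H] [InnerProductSpace ℝ H]

/-- Encoding a radius as `c⁻¹` lets finitely many local bounds share one large `c` by intersecting
filters. -/
theorem eventually_atTop_forall_ball {X : Type*} [PseudoMetricSpace X] {x₀ : X} {Q : X → Prop}
    (h : ∀ᶠ x in 𝓝 x₀, Q x) : ∀ᶠ c : ℝ in atTop, ∀ x ∈ Metric.ball x₀ c⁻¹, Q x := by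
  obtain ⟨r, hr, hQ⟩ := Metric.eventually_nhds_iff_ball.1 h
  filter_upwards [tendsto_inv_atTop_zero.eventually (gt_mem_nhds hr)] with c hc x hx
  exact hQ x (Metric.ball_subset_ball hc.le hx)

/-- At `p₀` independence gives an antilipschitz constant `K`. Gradients that move by less than `1 /
(2K)` in total cost half of `‖ν‖`, which is absorbed on the left. -/
theorem eventually_abs_le_mul_norm_sum [PseudoMetricSpace P] {g : ι → P → H} {p₀ : P}
    {M : Finset ι} (hg : ∀ i ∈ M, ContinuousAt (g i) p₀)
    (hM : LinearIndepOn ℝ (fun i => g i p₀) (M : Set ι)) :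
    ∀ᶠ c : ℝ in atTop, ∀ p ∈ Metric.ball p₀ c⁻¹, ∀ μ : ι → ℝ, ∀ i ∈ M,
      |μ i| ≤ c * ‖∑ j ∈ M, μ j • g j p‖ := by
  have hinj : LinearMap.ker (Fintype.linearCombination ℝ (fun i : M => g i p₀)) = ⊥ :=
    LinearMap.ker_eq_bot.2 (linearIndependent_iff_injective_fintypeLinearCombination.1 hM)
  obtain ⟨K, hK, hanti⟩ := LinearMap.exists_antilipschitzWith _ hinj
  have hK' : (0 : ℝ) < K := hK
  have hcont : ContinuousAt (fun p => ∑ j ∈ M, ‖g j p - g j p₀‖) p₀ :=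
    tendsto_finsetSum _ fun j hj => ((hg j hj).sub continuousAt_const).norm
  have hsmall : ∀ᶠ p in 𝓝 p₀, ∑ j ∈ M, ‖g j p - g j p₀‖ < (2 * (K : ℝ))⁻¹ := by
    refine hcont.eventually (gt_mem_nhds ?_)
    simp only [sub_self, norm_zero, Finset.sum_const_zero]
    positivity
  filter_upwards [eventually_atTop_forall_ball hsmall, eventually_ge_atTop (2 * (K : ℝ))]
    with c hc hKc p hp μ i hi
  set ν : M → ℝ := fun j => μ j
  have h₀ : ‖ν‖ ≤ K * ‖∑ j ∈ M, μ j • g j p₀‖ := by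
    have := hanti.le_mul_dist ν 0
    rw [dist_zero_right, map_zero, dist_zero_right, Fintype.linearCombination_apply] at this
    rwa [Finset.sum_coe_sort M (fun j => μ j • g j p₀)] at this
  have hle : ∀ j ∈ M, |μ j| ≤ ‖ν‖ := fun j hj => norm_le_pi_norm ν ⟨j, hj⟩
  have h₁ : ‖∑ j ∈ M, μ j • g j p₀‖ ≤
      ‖∑ j ∈ M, μ j • g j p‖ + ‖ν‖ * (2 * (K : ℝ))⁻¹ := by
    have h₂ : ‖∑ j ∈ M, μ j • (g j p - g j p₀)‖ ≤ ‖ν‖ * (2 * (K : ℝ))⁻¹ := by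
      calc _ ≤ ∑ j ∈ M, ‖ν‖ * ‖g j p - g j p₀‖ := by
            refine norm_sum_le_of_le _ fun j hj => ?_
            rw [norm_smul]
            exact mul_le_mul_of_nonneg_right (hle j hj) (norm_nonneg _)
        _ = ‖ν‖ * ∑ j ∈ M, ‖g j p - g j p₀‖ := by rw [Finset.mul_sum]
        _ ≤ _ := mul_le_mul_of_nonneg_left (hc p hp).le (norm_nonneg _)
    have h₃ : ∑ j ∈ M, μ j • g j p₀ =
        ∑ j ∈ M, μ j • g j p - ∑ j ∈ M, μ j • (g j p - g j p₀) := by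
      rw [← Finset.sum_sub_distrib]
      exact Finset.sum_congr rfl fun j _ => by module
    rw [h₃]
    exact (norm_sub_le _ _).trans (by gcongr)
  have h₄ : ‖ν‖ ≤ 2 * K * ‖∑ j ∈ M, μ j • g j p‖ := by
    have := h₀.trans (mul_le_mul_of_nonneg_left h₁ hK'.le)
    have h₅ : (K : ℝ) * (‖ν‖ * (2 * (K : ℝ))⁻¹) = ‖ν‖ / 2 := by field_simp
    rw [mul_add, h₅] at this
    linarith
  exact (hle i hi).trans (h₄.trans (mul_le_mul_of_nonneg_right hKc (norm_nonneg _)))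

/-- Turns constant rank into persistence of linear independence. -/
theorem linearIndepOn_iff_card_eq_finrank_span {M : Finset ι} {b : ι → H} :
    LinearIndepOn ℝ b (M : Set ι) ↔
      M.card = Module.finrank ℝ (Submodule.span ℝ (b '' (M : Set ι))) := by
  unfold LinearIndepOn
  rw [linearIndependent_iff_card_eq_finrank_span, Set.finrank, Set.image_eq_range]
  simp

variable [DecidableEq ι]

/-- Quantitative information on a constraint system near `(p₀, x₀)`, with one constant `c` that
bounds all Lipschitz constants and multipliers and whose inverse is the radius of validity. -/
structure LocalBounds [PseudoMetricSpace P] (I₁ I₂ : Finset ι) (f : ι → P → ℝ) (g : ι → P → H)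
    (p₀ : P) (x₀ : H) (c : ℝ) : Prop where
  pos : 0 < c
  lip_f : ∀ i ∈ I₁ ∪ I₂, ∀ p ∈ Metric.ball p₀ c⁻¹, ∀ q ∈ Metric.ball p₀ c⁻¹,
    |f i p - f i q| ≤ c * dist p q
  lip_g : ∀ i ∈ I₁ ∪ I₂, ∀ p ∈ Metric.ball p₀ c⁻¹, ∀ q ∈ Metric.ball p₀ c⁻¹,
    ‖g i p - g i q‖ ≤ c * dist p q
  act : ∀ i ∈ I₁ ∪ I₂, ∀ p ∈ Metric.ball p₀ c⁻¹, ∀ x ∈ Metric.ball x₀ c⁻¹,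
    inner ℝ x (g i p) = f i p → inner ℝ x₀ (g i p₀) = f i p₀
  rank : ∀ p ∈ Metric.ball p₀ c⁻¹, ∀ M : Finset ι, I₁ ⊆ M →
    (M : Set ι) ⊆ active I₁ I₂ f g p₀ x₀ →
    (LinearIndepOn ℝ (fun i => g i p) (M : Set ι) ↔
      LinearIndepOn ℝ (fun i => g i p₀) (M : Set ι))
  mult : ∀ M ⊆ I₁ ∪ I₂, LinearIndepOn ℝ (fun i => g i p₀) (M : Set ι) →
    ∀ p ∈ Metric.ball p₀ c⁻¹, ∀ μ : ι → ℝ, ∀ i ∈ M, |μ i| ≤ c * ‖∑ j ∈ M, μ j • g j p‖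

theorem eventually_dist_le_of_locallyLipschitz {X Y : Type*} [PseudoMetricSpace X]
    [PseudoMetricSpace Y] {h : X → Y} (hh : LocallyLipschitz h) (x₀ : X) :
    ∀ᶠ c : ℝ in atTop, ∀ p ∈ Metric.ball x₀ c⁻¹, ∀ q ∈ Metric.ball x₀ c⁻¹,
      dist (h p) (h q) ≤ c * dist p q := by
  obtain ⟨K, t, ht, hK⟩ := hh x₀
  filter_upwards [eventually_atTop_forall_ball ht, eventually_ge_atTop (K : ℝ)]
    with c hc hKc p hp q hq
  exact (hK.dist_le_mul p (hc p hp) q (hc q hq)).trans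
    (mul_le_mul_of_nonneg_right hKc dist_nonneg)

theorem eventually_localBounds [PseudoMetricSpace P] {I₁ I₂ : Finset ι} {f : ι → P → ℝ}
    {g : ι → P → H} {p₀ : P} {x₀ : H} (hf : ∀ i ∈ I₁ ∪ I₂, LocallyLipschitz (f i))
    (hg : ∀ i ∈ I₁ ∪ I₂, LocallyLipschitz (g i)) (hR : RCRCQ I₁ I₂ f g p₀ x₀) :
    ∀ᶠ c : ℝ in atTop, LocalBounds I₁ I₂ f g p₀ x₀ c := by
  have h_act : ∀ᶠ c : ℝ in atTop, ∀ i ∈ I₁ ∪ I₂, ∀ q ∈ Metric.ball (p₀, x₀) c⁻¹,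
      inner ℝ q.2 (g i q.1) = f i q.1 → inner ℝ x₀ (g i p₀) = f i p₀ := by
    refine (eventually_all_finset _).2 fun i hi => eventually_atTop_forall_ball ?_
    by_cases h : inner ℝ x₀ (g i p₀) = f i p₀
    · exact .of_forall fun _ _ => h
    · have hgc : ContinuousAt (fun q : P × H => g i q.1) (p₀, x₀) :=
        ((hg i hi).continuous.comp continuous_fst).continuousAt
      have hfc : ContinuousAt (fun q : P × H => f i q.1) (p₀, x₀) :=
        ((hf i hi).continuous.comp continuous_fst).continuousAt
      have hc : ContinuousAt (fun q : P × H => inner ℝ q.2 (g i q.1) - f i q.1) (p₀, x₀) :=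
        (Filter.Tendsto.inner continuousAt_snd hgc).sub hfc
      filter_upwards [hc.eventually_ne (sub_ne_zero.2 h)] with q hq hq'
      exact absurd (sub_eq_zero.2 hq') hq
  have h_rank : ∀ᶠ c : ℝ in atTop, ∀ p ∈ Metric.ball p₀ c⁻¹, ∀ M : Finset ι, I₁ ⊆ M →
      (M : Set ι) ⊆ active I₁ I₂ f g p₀ x₀ →
      (LinearIndepOn ℝ (fun i => g i p) (M : Set ι) ↔
        LinearIndepOn ℝ (fun i => g i p₀) (M : Set ι)) := by
    obtain ⟨-, U, hU, h⟩ := hR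
    filter_upwards [eventually_atTop_forall_ball hU] with c hc p hp M h₁ h₂
    rw [linearIndepOn_iff_card_eq_finrank_span, linearIndepOn_iff_card_eq_finrank_span,
      h M h₁ h₂ p (hc p hp)]
  have h_mult : ∀ᶠ c : ℝ in atTop, ∀ M ∈ (I₁ ∪ I₂).powerset,
      LinearIndepOn ℝ (fun i => g i p₀) (M : Set ι) →
      ∀ p ∈ Metric.ball p₀ c⁻¹, ∀ μ : ι → ℝ, ∀ i ∈ M, |μ i| ≤ c * ‖∑ j ∈ M, μ j • g j p‖ := by
    refine (eventually_all_finset _).2 fun M hM => ?_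
    by_cases h : LinearIndepOn ℝ (fun i => g i p₀) (M : Set ι)
    · exact (eventually_abs_le_mul_norm_sum
        (fun i hi => (hg i (Finset.mem_powerset.1 hM hi)).continuous.continuousAt) h).mono
        fun c hc _ => hc
    · exact .of_forall fun _ h' => absurd h' h
  filter_upwards [eventually_gt_atTop 0, h_act, h_rank, h_mult,
    (eventually_all_finset _).2 fun i hi => eventually_dist_le_of_locallyLipschitz (hf i hi) p₀,
    (eventually_all_finset _).2 fun i hi => eventually_dist_le_of_locallyLipschitz (hg i hi) p₀]
    with c h₀ ha hr hm hfl hgl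
  refine ⟨h₀, hfl, fun i hi p hp q hq => ?_, fun i hi p hp x hx => ?_, hr,
    fun M hM => hm M (Finset.mem_powerset.2 hM)⟩
  · rw [← dist_eq_norm]
    exact hgl i hi p hp q hq
  · exact ha i hi (p, x) (by rw [← ball_prod_same]; exact ⟨hp, hx⟩)

/-- The pseudo-Lipschitz property of a constraint system with linearly independent equations. -/
theorem eventually_exists_near [PseudoMetricSpace P] [CompleteSpace H] {I₁ I₂ E B : Finset ι}
    {f : ι → P → ℝ} {g : ι → P → H} {p₀ : P} {x₀ : H} {c₀ : ℝ}
    (hb : LocalBounds I₁ I₂ f g p₀ x₀ c₀) (hEB : E ∪ B = I₁ ∪ I₂) (hd : Disjoint E B)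
    (hE₁ : I₁ ⊆ E) (hE : (E : Set ι) ⊆ active I₁ I₂ f g p₀ x₀)
    (hind : LinearIndepOn ℝ (fun i => g i p₀) (E : Set ι))
    (hlow : x₀ ∈ lowerLimit (feasible E B f g) p₀) :
    ∀ᶠ c : ℝ in atTop, ∀ p ∈ Metric.ball p₀ c⁻¹, ∀ q ∈ Metric.ball p₀ c⁻¹,
      ∀ x ∈ Metric.ball x₀ c⁻¹, x ∈ feasible E B f g p →
        ∃ y ∈ feasible E B f g q, ‖x - y‖ ≤ c * dist p q := by
  have hc₀ := hb.pos
  -- With `x` and `w` within `c₀⁻¹ / 4` of `x₀`, the projection `y` of `x` stays within `3 c₀⁻¹ /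
  -- 4`, where the local bounds apply.
  obtain ⟨U, hU, hmeet⟩ := hlow (Metric.ball x₀ (c₀⁻¹ / 4))
    (Metric.ball_mem_nhds _ (by positivity))
  set R : ℝ := ‖x₀‖ + c₀⁻¹ with hRdef
  have hR : 0 ≤ R := by positivity
  filter_upwards [eventually_atTop_forall_ball hU, eventually_ge_atTop (4 * c₀),
    eventually_ge_atTop ((I₁ ∪ I₂).card * (c₀ * (c₀ * (R + 1))))] with c hcU hc4 hcN
  intro p hp q hq x hx hxp
  have hcr : c⁻¹ ≤ c₀⁻¹ / 4 := by
    calc c⁻¹ ≤ (4 * c₀)⁻¹ := inv_anti₀ (by positivity) hc4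
      _ = _ := by rw [mul_inv]; ring
  have hci : 0 < c₀⁻¹ := inv_pos.2 hc₀
  have hp' := Metric.ball_subset_ball (by linarith : c⁻¹ ≤ c₀⁻¹) hp
  have hq' := Metric.ball_subset_ball (by linarith : c⁻¹ ≤ c₀⁻¹) hq
  obtain ⟨w, hw, hwq⟩ := hmeet q (hcU q hq)
  obtain ⟨y, hy⟩ := exists_isProjection (convex_feasible E B) (isClosed_feasible E B) ⟨w, hwq⟩ x
  rw [mem_ball_iff_norm] at hx hw
  have hxw : ‖x - w‖ < c₀⁻¹ / 2 := by
    have : x - w = (x - x₀) - (w - x₀) := by abel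
    rw [this]
    linarith [norm_sub_le (x - x₀) (w - x₀)]
  have hxy : ‖x - y‖ ≤ ‖x - w‖ := (isProjection_iff_norm_le.1 hy).2 w hwq
  have hyx₀ : y ∈ Metric.ball x₀ c₀⁻¹ := by
    have : y - x₀ = (x - x₀) - (x - y) := by abel
    rw [mem_ball_iff_norm, this]
    linarith [norm_sub_le (x - x₀) (x - y)]
  have hxR : ‖x‖ ≤ R := by
    have : x = x₀ + (x - x₀) := by abel
    rw [this]
    linarith [norm_add_le x₀ (x - x₀)]
  obtain ⟨M, hMB, μ, hμ, hMact, hMind, hsum⟩ :=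
    hy.exists_multipliers B E hd ((hb.rank q hq' E hE₁ hE).2 hind)
  have hsub : E ∪ M ⊆ I₁ ∪ I₂ := hEB ▸ Finset.union_subset_union_right hMB
  have hEMact : ((E ∪ M : Finset ι) : Set ι) ⊆ active I₁ I₂ f g p₀ x₀ := by
    intro i hi
    rcases Finset.mem_union.1 (Finset.mem_coe.1 hi) with h | h
    · exact hE h
    · exact ⟨hsub hi, hb.act i (hsub hi) q hq' y hyx₀ (hMact i h)⟩
  have hbound := hb.mult _ hsub ((hb.rank q hq' _
    (hE₁.trans Finset.subset_union_left) hEMact).1 hMind) q hq' μ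
  rw [← hsum] at hbound
  refine ⟨y, hy.1, ?_⟩
  set δ := dist p q
  -- The residual `s` of `x` at `q` differs from the one at `p` by `O(δ)`. The latter is zero for an
  -- equation, so the sign of `μ i` is irrelevant; for an inequality it is nonpositive and `μ i ≥
  -- 0`.
  have hterm : ∀ i ∈ E ∪ M, inner ℝ (μ i • g i q) (x - y) ≤
      c₀ * ‖x - y‖ * (c₀ * (R + 1) * δ) := by
    intro i hi
    have hmi := hbound i hi
    have hact : inner ℝ y (g i q) = f i q := by
      rcases Finset.mem_union.1 hi with h | h
      · exact hy.1.1 i h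
      · exact hMact i h
    set s : ℝ := inner ℝ x (g i q) - f i q with hs
    have hs' : |s - (inner ℝ x (g i p) - f i p)| ≤ c₀ * (R + 1) * δ := by
      have h₁ : s - (inner ℝ x (g i p) - f i p) =
          -inner ℝ x (g i p - g i q) + (f i p - f i q) := by
        rw [inner_sub_right, hs]; ring
      have h₂ : |inner ℝ x (g i p - g i q)| ≤ R * (c₀ * δ) :=
        (abs_real_inner_le_norm _ _).trans
          (mul_le_mul hxR (hb.lip_g i (hsub hi) p hp' q hq') (norm_nonneg _) hR)
      have h₃ := hb.lip_f i (hsub hi) p hp' q hq'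
      rw [h₁]
      calc _ ≤ |(-inner ℝ x (g i p - g i q))| + |f i p - f i q| := abs_add_le _ _
        _ ≤ R * (c₀ * δ) + c₀ * δ := by rw [abs_neg]; exact add_le_add h₂ h₃
        _ = _ := by ring
    have hnn : 0 ≤ c₀ * (R + 1) * δ := (abs_nonneg _).trans hs'
    rw [real_inner_smul_left, real_inner_comm, inner_sub_left, hact]
    by_cases hiE : i ∈ E
    · rw [hxp.1 i hiE, sub_self, sub_zero] at hs'
      calc _ ≤ |μ i * s| := le_abs_self _
        _ = |μ i| * |s| := abs_mul _ _
        _ ≤ _ := mul_le_mul hmi hs' (abs_nonneg _) (by positivity)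
    · have hiM := (Finset.mem_union.1 hi).resolve_left hiE
      have h₁ : s ≤ c₀ * (R + 1) * δ := by
        linarith [le_abs_self (s - (inner ℝ x (g i p) - f i p)), hxp.2 i (hMB hiM)]
      calc _ ≤ μ i * (c₀ * (R + 1) * δ) := mul_le_mul_of_nonneg_left h₁ (hμ i hiM)
        _ ≤ _ := mul_le_mul_of_nonneg_right ((le_abs_self _).trans hmi) hnn
  -- The multipliers are themselves `O(‖x - y‖)`, so one factor `‖x - y‖` cancels.
  have hsq : ‖x - y‖ ^ 2 ≤ c * δ * ‖x - y‖ := by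
    have h₁ : ‖x - y‖ ^ 2 = ∑ i ∈ E ∪ M, inner ℝ (μ i • g i q) (x - y) := by
      rw [← sum_inner, ← hsum, real_inner_self_eq_norm_sq]
    have h₂ : ((E ∪ M).card : ℝ) ≤ (I₁ ∪ I₂).card := by
      exact_mod_cast Finset.card_le_card hsub
    have hδ : 0 ≤ δ := dist_nonneg
    calc _ ≤ (E ∪ M).card • (c₀ * ‖x - y‖ * (c₀ * (R + 1) * δ)) :=
          h₁ ▸ Finset.sum_le_card_nsmul _ _ _ hterm
      _ ≤ (I₁ ∪ I₂).card * (c₀ * ‖x - y‖ * (c₀ * (R + 1) * δ)) := by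
          rw [nsmul_eq_mul]; gcongr
      _ = (I₁ ∪ I₂).card * (c₀ * (c₀ * (R + 1))) * (δ * ‖x - y‖) := by ring
      _ ≤ c * (δ * ‖x - y‖) := by gcongr
      _ = _ := by ring
  rcases (norm_nonneg (x - y)).eq_or_lt with h | h
  · rw [← h]
    exact mul_nonneg (by linarith) dist_nonneg
  · rw [sq] at hsq
    exact le_of_mul_le_mul_right hsq h

end LocalBounds


/-! ### Stable representations and Lipschitz dependence on the parameter. -/

section Structure

variable {ι P H : Type*} [DecidableEq ι] [NormedAddCommGroup H]
  [InnerProductSpace ℝ H]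

/-- Turning some inequalities into equations shrinks the feasible set. -/
theorem reduced_subset_feasible {I₁ I₂ K L : Finset ι} {f : ι → P → ℝ} {g : ι → P → H} {p : P} :
    reduced I₁ I₂ f g K L p ⊆ feasible I₁ I₂ f g p := by
  refine fun x hx => ⟨fun i hi => hx.1 i (by simp [hi]), fun i hi => ?_⟩
  by_cases h : i ∈ K ∪ L
  · exact (hx.1 i (by rw [Finset.union_assoc]; exact Finset.mem_union_right _ h)).le
  · exact hx.2 i (Finset.mem_sdiff.2 ⟨hi, h⟩)

theorem reduced_union_eq {I₁ I₂ K L : Finset ι} (hK : K ⊆ I₂) (hL : L ⊆ I₂) :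
    (I₁ ∪ K ∪ L) ∪ (I₂ \ (K ∪ L)) = I₁ ∪ I₂ := by
  rw [Finset.union_assoc I₁, Finset.union_assoc I₁,
    Finset.union_sdiff_of_subset (Finset.union_subset hK hL)]

theorem reduced_disjoint {I₁ I₂ K L : Finset ι} (hd : Disjoint I₁ I₂) :
    Disjoint (I₁ ∪ K ∪ L) (I₂ \ (K ∪ L)) := by
  rw [Finset.union_assoc, Finset.disjoint_union_left]
  exact ⟨hd.mono_right Finset.sdiff_subset, Finset.disjoint_sdiff⟩

theorem reduced_subset_active {I₁ I₂ K L : Finset ι} {f : ι → P → ℝ} {g : ι → P → H} {p : P}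
    {x : H} (hx : x ∈ feasible I₁ I₂ f g p) (hK : (K : Set ι) ⊆ active I₁ I₂ f g p x)
    (hL : (L : Set ι) ⊆ active I₁ I₂ f g p x) :
    ((I₁ ∪ K ∪ L : Finset ι) : Set ι) ⊆ active I₁ I₂ f g p x := by
  intro i hi
  rcases Finset.mem_union.1 (Finset.mem_coe.1 hi) with h | h
  · rcases Finset.mem_union.1 h with h | h
    · exact ⟨Finset.mem_union_left _ h, hx.1 i h⟩
    · exact hK h
  · exact hL h

/-- At the parameter `(v, p)` the constraints with index in `I₁ ∪ K ∪ L` are active at `x`, and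
`lam` are multipliers for them that are bounded by `C`. -/
structure IsKKTPoint (I₁ I₂ : Finset ι) (f : ι → P → ℝ) (g : ι → P → H) (K : Finset ι)
    (C : ℝ) (v : H) (p : P) (x : H) (L : Finset ι) (lam : ι → ℝ) : Prop where
  mem : x ∈ reduced I₁ I₂ f g K L p
  nonneg : ∀ i ∈ K ∪ L, 0 ≤ lam i
  bound : ∀ i ∈ I₁ ∪ K ∪ L, |lam i| ≤ C
  sum : v - x = ∑ i ∈ I₁ ∪ K ∪ L, lam i • g i p

theorem isProjection_of_reduced {I₁ I₂ K L : Finset ι} {f : ι → P → ℝ} {g : ι → P → H} {p : P}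
    {v x : H} {lam : ι → ℝ} (hK : K ⊆ I₂) (hL : L ⊆ I₂) (hx : x ∈ reduced I₁ I₂ f g K L p)
    (hlam : ∀ i ∈ K ∪ L, 0 ≤ lam i) (hv : v - x = ∑ i ∈ I₁ ∪ K ∪ L, lam i • g i p) :
    IsProjection (feasible I₁ I₂ f g p) v x := by
  refine isProjection_of_multipliers (reduced_subset_feasible hx) ?_ hx.1 ?_ hv
  · rw [Finset.union_assoc]
    exact Finset.union_subset_union_right (Finset.union_subset hK hL)
  · intro i hi h
    rw [Finset.union_assoc] at hi
    exact hlam i ((Finset.mem_union.1 hi).resolve_left h)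

/-- Near `(v₀, p₀)` the projections onto the feasible sets are given by KKT points with bounded
multipliers and an admissible index set. -/
theorem eventually_exists_isKKTPoint [PseudoMetricSpace P] [CompleteSpace H] {I₁ I₂ K : Finset ι}
    (hdisj : Disjoint I₁ I₂) {f : ι → P → ℝ} {g : ι → P → H} {p₀ : P} {v₀ x₀ : H}
    (hg : ∀ i ∈ I₁ ∪ I₂, LocallyLipschitz (g i)) {c : ℝ}
    (hb : LocalBounds I₁ I₂ f g p₀ x₀ c) (hS : IsStableWith I₁ I₂ f g p₀ v₀ x₀ K) :
    ∃ C, 0 < C ∧ ∀ ε > 0, ∀ᶠ q in 𝓝 v₀ ×ˢ 𝓝 p₀, ∃ x ∈ Metric.ball x₀ ε, ∃ L lam,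
      Admissible I₁ I₂ f g p₀ x₀ K L ∧ IsKKTPoint I₁ I₂ f g K C q.1 q.2 x L lam := by
  obtain ⟨-, hx₀, hK, ⟨lam, hlam, hv⟩, hind, hlow⟩ := hS
  have hc := hb.pos
  have hKI : K ⊆ I₂ := fun i hi => (hK hi).2
  have hKact : (K : Set ι) ⊆ active I₁ I₂ f g p₀ x₀ := fun i hi => (hK hi).1
  have hE₀ := reduced_subset_active hx₀ hKact (L := ∅) (by simp)
  rw [Finset.union_empty] at hE₀
  have hcont : ContinuousAt (fun p => ∑ i ∈ I₁ ∪ K, lam i • g i p) p₀ := by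
    refine tendsto_finsetSum _ fun i hi => ?_
    exact ((hg i (Finset.union_subset_union_right hKI hi)).continuous.continuousAt).const_smul _
  refine ⟨1 + ∑ i ∈ I₁ ∪ K, |lam i|, by positivity, fun ε hε => ?_⟩
  -- Below, `4 * η` bounds `‖z - x₀‖` and `c * (6 * η)` the change of the multipliers: less than
  -- `lam i` on `K` to keep them positive, less than `1` to keep them bounded by the chosen
  -- constant.
  have hη : ∀ᶠ η : ℝ in 𝓝[>] 0, (0 < η ∧ 4 * η < ε ∧ 4 * η < c⁻¹ ∧ c * (6 * η) < 1) ∧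
      ∀ i ∈ K, c * (6 * η) < lam i := by
    have hlt : ∀ (a b : ℝ), 0 < b → ∀ᶠ η : ℝ in 𝓝[>] 0, a * η < b := fun a b h => by
      have : ContinuousAt (fun η : ℝ => a * η) 0 := by fun_prop
      exact (this.eventually (gt_mem_nhds (by simpa using h))).filter_mono nhdsWithin_le_nhds
    refine .and (eventually_mem_nhdsWithin.and ((hlt 4 ε hε).and ((hlt 4 _ (inv_pos.2 hc)).and ?_)))
      ((eventually_all_finset K).2 fun i hi => ?_)
    · simpa only [mul_assoc] using hlt (c * 6) 1 one_pos
    · simpa only [mul_assoc] using hlt (c * 6) _ (hlam i hi)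
  obtain ⟨η, ⟨hη₀, hηε, hηc, hη₁⟩, hηK⟩ := hη.exists
  have hadm : Admissible I₁ I₂ f g p₀ x₀ K ∅ := ⟨by simp, by simpa using hind⟩
  obtain ⟨U, hU, hmeet⟩ := hlow ∅ hadm (Metric.ball x₀ η) (Metric.ball_mem_nhds _ hη₀)
  have hw : ∀ᶠ p in 𝓝 p₀, ∑ i ∈ I₁ ∪ K, lam i • g i p ∈
      Metric.ball (∑ i ∈ I₁ ∪ K, lam i • g i p₀) η := hcont (Metric.ball_mem_nhds _ hη₀)
  filter_upwards [(eventually_of_mem (Metric.ball_mem_nhds v₀ hη₀) fun _ h => h).prod_mk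
    ((eventually_of_mem hU fun _ h => h).and
    (hw.and (Metric.ball_mem_nhds p₀ (inv_pos.2 hc))))]
  rintro ⟨v, p⟩ ⟨hvv, hpU, hwp, hp⟩
  dsimp only at hvv hpU hwp hp ⊢
  obtain ⟨y, hy, hyp⟩ := hmeet p hpU
  set w := ∑ i ∈ I₁ ∪ K, lam i • g i p with hwdef
  rw [← hv] at hwp
  rw [mem_ball_iff_norm] at hvv hy hwp
  set B := I₂ \ K with hBdef
  have hred : reduced I₁ I₂ f g K ∅ p = feasible (I₁ ∪ K) B f g p := by
    simp [reduced, hBdef]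
  rw [hred] at hyp
  have hdB : Disjoint (I₁ ∪ K) B := by
    simpa using reduced_disjoint (K := K) (L := ∅) hdisj
  obtain ⟨z, hz⟩ :=
    exists_isProjection (convex_feasible (I₁ ∪ K) B) (isClosed_feasible _ _) ⟨y, hyp⟩ v
  have hvyw : ‖v - y - w‖ < 3 * η := by
    have : v - y - w = (v - v₀) - (y - x₀) - (w - (v₀ - x₀)) := by abel
    rw [this]
    linarith [norm_sub_le ((v - v₀) - (y - x₀)) (w - (v₀ - x₀)),
      norm_sub_le (v - v₀) (y - x₀)]
  -- `w` is orthogonal to `z - y`, since both points solve the equations. So `y` is the projection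
  -- of `y + w`, and this is nonexpansiveness.
  have hzy : ‖z - y‖ ≤ ‖v - y - w‖ := by
    have horth : inner ℝ w (z - y) = 0 := by
      rw [hwdef, sum_inner]
      refine Finset.sum_eq_zero fun i hi => ?_
      rw [real_inner_smul_left, real_inner_comm, inner_sub_left, hz.1.1 i hi, hyp.1 i hi, sub_self,
        mul_zero]
    have hproj := ((isProjection_iff_inner_le (convex_feasible _ _)).1 hz).2 y hyp
    have hsq : ‖z - y‖ ^ 2 ≤ ‖v - y - w‖ * ‖z - y‖ := by
      refine le_trans ?_ (real_inner_le_norm _ _)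
      have h₁ : v - y - w = (v - z) + (z - y) - w := by abel
      have h₂ : inner ℝ (v - z) (z - y) = -inner ℝ (v - z) (y - z) := by
        rw [← inner_neg_right, neg_sub]
      rw [h₁, inner_sub_left, inner_add_left, horth, real_inner_self_eq_norm_sq, h₂]
      linarith
    rcases (norm_nonneg (z - y)).eq_or_lt with h | h
    · rw [← h]; exact norm_nonneg _
    · rw [sq] at hsq
      exact le_of_mul_le_mul_right hsq h
  have hzx₀ : ‖z - x₀‖ < 4 * η := by
    have : z - x₀ = (z - y) + (y - x₀) := by abel
    rw [this]
    linarith [norm_add_le (z - y) (y - x₀)]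
  have hvzw : ‖v - z - w‖ < 6 * η := by
    have : v - z - w = (v - y - w) - (z - y) := by abel
    rw [this]
    linarith [norm_sub_le (v - y - w) (z - y)]
  obtain ⟨L, hLB, μ, hμ, hLact, hLind, hsum⟩ := hz.exists_multipliers B (I₁ ∪ K) hdB
    ((hb.rank p hp _ Finset.subset_union_left hE₀).2 hind)
  have hLI : L ⊆ I₂ := hLB.trans Finset.sdiff_subset
  have hLA : (L : Set ι) ⊆ active I₁ I₂ f g p₀ x₀ := fun i hi => by
    have hi' : i ∈ I₁ ∪ I₂ := Finset.mem_union_right _ (hLI hi)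
    exact ⟨hi', hb.act i hi' p hp z (mem_ball_iff_norm.2 (by linarith)) (hLact i hi)⟩
  have hEL := reduced_subset_active hx₀ hKact hLA
  have hind₀ := (hb.rank p hp _
    ((Finset.subset_union_left.trans Finset.subset_union_left)) hEL).1 hLind
  have hsub : I₁ ∪ K ∪ L ⊆ I₁ ∪ I₂ := fun i hi => (hEL hi).1
  -- Extension by zero to `L`, so that both families of multipliers are compared over the same
  -- independent gradients.
  set lam' : ι → ℝ := fun i => if i ∈ I₁ ∪ K then lam i else 0 with hlam'
  have hdiff : ∑ i ∈ I₁ ∪ K ∪ L, (μ i - lam' i) • g i p = v - z - w := by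
    have : ∑ i ∈ I₁ ∪ K ∪ L, lam' i • g i p = w := by
      rw [hwdef, ← Finset.sum_subset (Finset.subset_union_left (s₂ := L))]
      · exact Finset.sum_congr rfl fun i hi => by simp only [hlam', if_pos hi]
      · intro i _ hi
        simp only [hlam', if_neg hi, zero_smul]
    simp only [sub_smul, Finset.sum_sub_distrib, this, ← hsum]
  have hclose : ∀ i ∈ I₁ ∪ K ∪ L, |μ i - lam' i| < c * (6 * η) := fun i hi => by
    have := hb.mult _ hsub hind₀ p hp (fun i => μ i - lam' i) i hi
    rw [hdiff] at this
    exact this.trans_lt (mul_lt_mul_of_pos_left hvzw hc)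
  refine ⟨z, mem_ball_iff_norm.2 (by linarith), L, μ, ⟨fun i hi => ⟨⟨hLA hi, hLI hi⟩,
    fun h => (Finset.mem_sdiff.1 (hLB hi)).2 h⟩, hind₀⟩, ?_, ?_, ?_, hsum⟩
  · refine ⟨fun i hi => ?_, fun i hi => ?_⟩
    · rcases Finset.mem_union.1 hi with h | h
      · exact hz.1.1 i h
      · exact hLact i h
    · rw [Finset.mem_sdiff, Finset.mem_union, not_or] at hi
      exact hz.1.2 i (Finset.mem_sdiff.2 ⟨hi.1, hi.2.1⟩)
  · intro i hi
    by_cases hiL : i ∈ L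
    · exact hμ i hiL
    -- On `K` the constraints were equations in this projection, so the sign comes only from
    -- closeness to `lam i > 0`.
    · have hiK := (Finset.mem_union.1 hi).resolve_right hiL
      have hiE : i ∈ I₁ ∪ K := Finset.mem_union_right _ hiK
      have h₁ := hclose i (Finset.mem_union_left _ hiE)
      simp only [hlam', if_pos hiE] at h₁
      linarith [(abs_lt.1 h₁).1, hηK i hiK]
  · intro i hi
    have h₁ : |lam' i| ≤ ∑ i ∈ I₁ ∪ K, |lam i| := by
      by_cases hiE : i ∈ I₁ ∪ K
      · simp only [hlam', if_pos hiE]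
        exact Finset.single_le_sum (f := fun i => |lam i|) (fun j _ => abs_nonneg _) hiE
      · simp only [hlam', if_neg hiE, abs_zero]
        positivity
    have h₂ : μ i = (μ i - lam' i) + lam' i := by ring
    rw [h₂]
    linarith [abs_add_le (μ i - lam' i) (lam' i), hclose i hi]

/-- The projection depends on the parameter in a Lipschitz way, uniformly in the projected point. -/
theorem eventually_projection_lipschitz [PseudoMetricSpace P] [CompleteSpace H] {I₁ I₂ K : Finset ι}
    (hdisj : Disjoint I₁ I₂) {f : ι → P → ℝ} {g : ι → P → H} {p₀ : P} {v₀ x₀ : H}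
    (hf : ∀ i ∈ I₁ ∪ I₂, LocallyLipschitz (f i)) (hg : ∀ i ∈ I₁ ∪ I₂, LocallyLipschitz (g i))
    (hR : RCRCQ I₁ I₂ f g p₀ x₀) (hS : IsStableWith I₁ I₂ f g p₀ v₀ x₀ K) :
    ∃ W ∈ 𝓝 v₀, ∃ U ∈ 𝓝 p₀,
      (∀ v ∈ W, ∀ p ∈ U, ∃ x, IsProjection (feasible I₁ I₂ f g p) v x) ∧
      ∃ l : ℝ, 0 < l ∧ ∀ v ∈ W, ∀ p ∈ U, ∀ q ∈ U, ∀ x y,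
        IsProjection (feasible I₁ I₂ f g p) v x → IsProjection (feasible I₁ I₂ f g q) v y →
          ‖x - y‖ ≤ l * dist p q := by
  obtain ⟨c₀, hb⟩ := (eventually_localBounds hf hg hR).exists
  have hKI : K ⊆ I₂ := fun i hi => (hS.2.2.1 hi).2
  have hKact : (K : Set ι) ⊆ active I₁ I₂ f g p₀ x₀ := fun i hi => (hS.2.2.1 hi).1
  have hx₀ := hS.2.1
  have hnear : ∀ᶠ c : ℝ in atTop, ∀ L ∈ I₂.powerset, Admissible I₁ I₂ f g p₀ x₀ K L →
      ∀ p ∈ Metric.ball p₀ c⁻¹, ∀ q ∈ Metric.ball p₀ c⁻¹,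
      ∀ x ∈ Metric.ball x₀ c⁻¹, x ∈ reduced I₁ I₂ f g K L p →
        ∃ y ∈ reduced I₁ I₂ f g K L q, ‖x - y‖ ≤ c * dist p q := by
    refine (eventually_all_finset _).2 fun L hL => ?_
    by_cases hadm : Admissible I₁ I₂ f g p₀ x₀ K L
    · refine (eventually_exists_near hb (reduced_union_eq hKI (Finset.mem_powerset.1 hL))
        (reduced_disjoint hdisj) (Finset.subset_union_left.trans Finset.subset_union_left)
        (reduced_subset_active hx₀ hKact fun i hi => (hadm.1 hi).1.1) hadm.2
        (hS.2.2.2.2.2 L hadm)).mono fun c hc _ => hc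
    · exact .of_forall fun _ h => absurd h hadm
  obtain ⟨c, hc, hcpos, hc₀⟩ :=
    (hnear.and ((eventually_gt_atTop 0).and (eventually_ge_atTop c₀))).exists
  have hcinv : c⁻¹ ≤ c₀⁻¹ := inv_anti₀ hb.pos hc₀
  obtain ⟨C, hC, hkkt⟩ := eventually_exists_isKKTPoint hdisj hg hb hS
  obtain ⟨W, hW, U, hU, hWU⟩ :
      ∃ W ∈ 𝓝 v₀, ∃ U ∈ 𝓝 p₀, ∀ v ∈ W, ∀ p ∈ U, ∃ x ∈ Metric.ball x₀ c⁻¹, ∃ L lam,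
        Admissible I₁ I₂ f g p₀ x₀ K L ∧ IsKKTPoint I₁ I₂ f g K C v p x L lam := by
    obtain ⟨W, hW, U, hU, h⟩ := mem_prod_iff.1 (hkkt c⁻¹ (inv_pos.2 hcpos))
    exact ⟨W, hW, U, hU, fun v hv p hp => h (Set.mk_mem_prod hv hp)⟩
  have hLI : ∀ L, Admissible I₁ I₂ f g p₀ x₀ K L → L ⊆ I₂ := fun L h i hi => (h.1 hi).1.2
  set N : ℝ := (((I₁ ∪ I₂).card : ℕ) : ℝ)
  refine ⟨W, hW, U ∩ Metric.ball p₀ c⁻¹, inter_mem hU (Metric.ball_mem_nhds _ (inv_pos.2 hcpos)),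
    fun v hv p hp => ?_, 2 * c + N * (C * c₀), ?_, ?_⟩
  · obtain ⟨x, -, L, lam, hadm, h⟩ := hWU v hv p hp.1
    exact ⟨x, isProjection_of_reduced hKI (hLI L hadm) h.mem h.nonneg h.sum⟩
  · have := hb.pos
    positivity
  intro v hv p hp q hq x y hx hy
  obtain ⟨x', hx'b, L, lam, hadm, h⟩ := hWU v hv p hp.1
  obtain rfl : x = x' := hx.unique (convex_feasible _ _)
    (isProjection_of_reduced hKI (hLI L hadm) h.mem h.nonneg h.sum)
  obtain ⟨z, hz, hxz⟩ := hc L (Finset.mem_powerset.2 (hLI L hadm)) hadm p hp.2 q hq.2 x hx'b h.mem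
  -- The multipliers found at `p` are reused at `q`.
  have hz' : IsProjection (feasible I₁ I₂ f g q) (z + ∑ i ∈ I₁ ∪ K ∪ L, lam i • g i q) z :=
    isProjection_of_reduced hKI (hLI L hadm) hz h.nonneg (by abel)
  have hzy := hz'.norm_sub_le (convex_feasible _ _) hy
  have hsub : I₁ ∪ K ∪ L ⊆ I₁ ∪ I₂ := fun i hi =>
    (reduced_subset_active hx₀ hKact (fun i hi => (hadm.1 hi).1.1) hi).1
  have hp' := Metric.ball_subset_ball hcinv hp.2
  have hq' := Metric.ball_subset_ball hcinv hq.2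
  have hshift : ‖z + ∑ i ∈ I₁ ∪ K ∪ L, lam i • g i q - v‖ ≤
      c * dist p q + N * (C * (c₀ * dist p q)) := by
    have h₁ : z + ∑ i ∈ I₁ ∪ K ∪ L, lam i • g i q - v =
        -(x - z) - ∑ i ∈ I₁ ∪ K ∪ L, lam i • (g i p - g i q) := by
      have : v = x + ∑ i ∈ I₁ ∪ K ∪ L, lam i • g i p := by rw [← h.sum]; abel
      simp only [smul_sub, Finset.sum_sub_distrib]
      rw [this]
      abel
    have h₂ : ‖∑ i ∈ I₁ ∪ K ∪ L, lam i • (g i p - g i q)‖ ≤ N * (C * (c₀ * dist p q)) := by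
      have hnn : 0 ≤ C * (c₀ * dist p q) := by have := hb.pos; positivity
      calc _ ≤ ∑ i ∈ I₁ ∪ K ∪ L, C * (c₀ * dist p q) := by
            refine norm_sum_le_of_le _ fun i hi => ?_
            rw [norm_smul]
            exact mul_le_mul (h.bound i hi) (hb.lip_g i (hsub hi) p hp' q hq') (norm_nonneg _) hC.le
        _ = (I₁ ∪ K ∪ L).card * (C * (c₀ * dist p q)) := by
            rw [Finset.sum_const, nsmul_eq_mul]
        _ ≤ _ := mul_le_mul_of_nonneg_right
            (Nat.cast_le.2 (Finset.card_le_card hsub)) hnn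
    rw [h₁]
    refine (norm_sub_le _ _).trans (add_le_add ?_ h₂)
    rwa [norm_neg]
  have : x - y = (x - z) + (z - y) := by abel
  rw [this]
  calc _ ≤ ‖x - z‖ + ‖z - y‖ := norm_add_le _ _
    _ ≤ c * dist p q + (c * dist p q + N * (C * (c₀ * dist p q))) :=
        add_le_add hxz (hzy.trans hshift)
    _ = _ := by ring

end Structure

end ParamProj

/-! ### The main theorem. -/

theorem theorem5p4 {ι G H : Type*} [DecidableEq ι]
    [NormedAddCommGroup G] [NormedSpace ℝ G]
    [NormedAddCommGroup H] [InnerProductSpace ℝ H] [CompleteSpace H]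
    (D : Set G) (I₁ I₂ : Finset ι) (hdisj : Disjoint I₁ I₂) (hne : (I₁ ∪ I₂).Nonempty)
    (f : ι → D → ℝ) (g : ι → D → H)
    (hf : ∀ i ∈ I₁ ∪ I₂, LocallyLipschitz (f i))
    (hg : ∀ i ∈ I₁ ∪ I₂, LocallyLipschitz (g i))
    (p₀ : D) (v₀ x₀ : H)
    (hv : v₀ ∉ ParamProj.feasible I₁ I₂ f g p₀)
    (hR : ParamProj.RCRCQ I₁ I₂ f g p₀ x₀)
    (hS : ∃ K : Finset ι, ParamProj.IsStableWith I₁ I₂ f g p₀ v₀ x₀ K) :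
    ∃ W ∈ 𝓝 v₀, ∃ U ∈ 𝓝 p₀,
      (∀ v ∈ W, ∀ p ∈ U, ParamProj.IsProjection (ParamProj.feasible I₁ I₂ f g p) v
        (ParamProj.projection (ParamProj.feasible I₁ I₂ f g p) v)) ∧
      ∃ l : ℝ, 0 < l ∧ ∀ v₁ ∈ W, ∀ p₁ ∈ U, ∀ v₂ ∈ W, ∀ p₂ ∈ U,
        ‖(v₁ - v₂) - (2 : ℝ) • (ParamProj.projection (ParamProj.feasible I₁ I₂ f g p₁) v₁
            - ParamProj.projection (ParamProj.feasible I₁ I₂ f g p₂) v₂)‖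
          ≤ ‖v₁ - v₂‖ + l * ‖(p₁ : G) - (p₂ : G)‖ := by
  obtain ⟨K, hK⟩ := hS
  obtain ⟨W, hW, U, hU, hex, l, hl, hlip⟩ :=
    ParamProj.eventually_projection_lipschitz hdisj hf hg hR hK
  have hproj : ∀ v ∈ W, ∀ p ∈ U, ParamProj.IsProjection (ParamProj.feasible I₁ I₂ f g p) v
      (ParamProj.projection (ParamProj.feasible I₁ I₂ f g p) v) := fun v hv p hp => by
    obtain ⟨x, hx⟩ := hex v hv p hp
    rwa [hx.projection_eq (ParamProj.convex_feasible _ _)]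
  -- The factor `2` comes from the reflection, applied to the change of parameter.
  refine ⟨W, hW, U, hU, hproj, 2 * l, by positivity, fun v₁ h₁ p₁ k₁ v₂ h₂ p₂ k₂ => ?_⟩
  have hrefl := (hproj v₁ h₁ p₁ k₁).norm_sub_two_smul_sub_le (ParamProj.convex_feasible _ _)
    (hproj v₂ h₂ p₁ k₁)
  have hpar := hlip v₂ h₂ p₁ k₁ p₂ k₂ _ _ (hproj v₂ h₂ p₁ k₁) (hproj v₂ h₂ p₂ k₂)
  rw [Subtype.dist_eq, dist_eq_norm] at hpar
  set a := ParamProj.projection (ParamProj.feasible I₁ I₂ f g p₁) v₁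
  set b := ParamProj.projection (ParamProj.feasible I₁ I₂ f g p₁) v₂
  set d := ParamProj.projection (ParamProj.feasible I₁ I₂ f g p₂) v₂
  have : (v₁ - v₂) - (2 : ℝ) • (a - d) = ((v₁ - v₂) - (2 : ℝ) • (a - b)) - (2 : ℝ) • (b - d) := by
    module
  rw [this]
  refine (norm_sub_le _ _).trans ?_
  rw [norm_smul, Real.norm_two]
  linarith
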